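/- An algebraic formula over $\mathbb{C}$ is a rooted tree whose leaves are labelled by variables or complex constants and whose inner nodes are $+$ or $\times$ gates of arbitrary positive fan-in; the edges entering a $+$ gate carry complex constants, so that the gate computes a linear combination of its children. The size of a formula is its number of nodes, and its depth is the length of a longest root-to-leaf path. For a sequence $\lambda=(\lambda_1,\dots,\lambda_\ell)$ of natural numbers put $\lambda_j=0$ for $j>\ell$, and for $n\ge \ell$ consider the generalized Vandermonde determinant $$a_{\lambda+\delta}(x_1,\dots,x_n)=\det\bigl(x_i^{\lambda_j+n-j}\bigr)_{1\le i,j\le n}\in\mathbb{C}[x_1,\dots,x_n].$$ Call $(\lambda,n)$ with $\ell\ge 1$ admissible if $\lambda_i\ge\lambda_{i+1}+(\ell-1)$ for all $1\le i\le \ell-1$, $\lambda_\ell\ge \ell$, and $n\ge\lambda_1+\ell$. Let $\det_\ell$ be the determinant of an $\ell\times\ell$ matrix of $\ell^2$ independent variables. (1) There are a polynomial $p$ with natural-number coefficients and a constant $c\in\mathbb{N}$ such that, for every $\ell \ge 1$, every admissible $(\lambda,n)$ with $\lambda=(\lambda_1,\dots,\lambda_\ell)$, and all $s,\Delta\in\mathbb{N}$: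 if $a_{\lambda+\delta}(x_1,\dots,x_n)$ has an algebraic formula of size at most $s$ and depth at most $\Delta$, then $\det_\ell$ has an algebraic formula of size at most $p(s)$ and depth at most $\Delta+c$. (2) Such exponents can be taken polynomially large: there is a polynomial $q$ with natural-number coefficients such that for every $\ell\ge1$ there is an admissible $(\lambda,n)$ with $\lambda=(\lambda_1,\dots,\lambda_\ell)$, with $n\le q(\ell)$ and all exponents $\lambda_j+n-j$ $(1\le j\le n)$ at most $q(\ell)$. -/

import Mathlib

/-- Algebraic formulas over the field `K` in the variables `σ`: rooted trees whose leaves are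
labelled by variables or field constants and whose inner nodes are sum gates or product gates of
arbitrary fan-in `k + 1 ≥ 1`. The edges entering a sum gate carry field constants, so that a sum
gate computes a linear combination of its children. -/
inductive AlgFormula (K : Type) (σ : Type) : Type
  | var (x : σ) : AlgFormula K σ
  | const (a : K) : AlgFormula K σ
  | sum (k : ℕ) (c : Fin (k + 1) → K) (f : Fin (k + 1) → AlgFormula K σ) : AlgFormula K σ
  | prod (k : ℕ) (f : Fin (k + 1) → AlgFormula K σ) : AlgFormula K σ

namespace AlgFormula

/-- The polynomial computed by a formula. -/
noncomputable def toPoly {K σ : Type} [Field K] : AlgFormula K σ → MvPolynomial σ K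
  | var x => MvPolynomial.X x
  | const a => MvPolynomial.C a
  | sum _ c f => ∑ i, MvPolynomial.C (c i) * (f i).toPoly
  | prod _ f => ∏ i, (f i).toPoly

/-- The size of a formula: the number of nodes of the tree, leaves included. -/
def size {K σ : Type} : AlgFormula K σ → ℕ
  | var _ => 1
  | const _ => 1
  | sum _ _ f => 1 + ∑ i, (f i).size
  | prod _ f => 1 + ∑ i, (f i).size

/-- The depth of a formula: the number of edges on a longest path from the root to a leaf. -/
def depth {K σ : Type} : AlgFormula K σ → ℕ
  | var _ => 0
  | const _ => 0
  | sum _ _ f => 1 + Finset.univ.sup fun i => (f i).depth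
  | prod _ f => 1 + Finset.univ.sup fun i => (f i).depth

end AlgFormula

/-- `P` is computed by a single algebraic formula of size at most `s` and depth at most `Δ`. -/
def HasFormula {K σ : Type} [Field K] (P : MvPolynomial σ K) (s Δ : ℕ) : Prop :=
  ∃ F : AlgFormula K σ, F.toPoly = P ∧ F.size ≤ s ∧ F.depth ≤ Δ

/-- The generalized Vandermonde determinant `det (x_i ^ μ_j)` in the variables `x_1, …, x_n`. -/
noncomputable def genVandermondeDet {n : ℕ} (μ : Fin n → ℕ) : MvPolynomial (Fin n) ℂ :=
  Matrix.det (Matrix.of fun i j : Fin n => (MvPolynomial.X i : MvPolynomial (Fin n) ℂ) ^ μ j)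

/-- The exponent vector `λ + δ`, where `λ = (λ_1, …, λ_ℓ)` is padded with zeros to length `n` and
`δ = (n - 1, …, 1, 0)`. Indices start at `0` here, so that the entry `λ_j + n - j` of the usual
numbering sits at the index `j - 1`. -/
def shiftedExponents {ℓ : ℕ} (n : ℕ) (lam : Fin ℓ → ℕ) (j : Fin n) : ℕ :=
  (if h : (j : ℕ) < ℓ then lam ⟨j, h⟩ else 0) + (n - 1 - (j : ℕ))

/-- The condition on `λ = (λ_1, …, λ_ℓ)` and the number `n` of variables: `ℓ ≥ 1`,
`λ_i ≥ λ_{i+1} + (ℓ - 1)` for `1 ≤ i ≤ ℓ - 1`, `λ_ℓ ≥ ℓ`, and `n ≥ λ_1 + ℓ`. -/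
def Admissible {ℓ : ℕ} (n : ℕ) (lam : Fin ℓ → ℕ) : Prop :=
  0 < ℓ ∧
  (∀ i j : Fin ℓ, (j : ℕ) = (i : ℕ) + 1 → lam j + (ℓ - 1) ≤ lam i) ∧
  (∀ i : Fin ℓ, (i : ℕ) + 1 = ℓ → ℓ ≤ lam i) ∧
  (∀ i : Fin ℓ, (i : ℕ) = 0 → lam i + ℓ ≤ n)

/-- The symbolic `ℓ × ℓ` determinant, a polynomial in `ℓ ^ 2` independent variables. -/
noncomputable def symbolicDet (ℓ : ℕ) : MvPolynomial (Fin ℓ × Fin ℓ) ℂ :=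
  (Matrix.mvPolynomialX (Fin ℓ) (Fin ℓ) ℂ).det

/-!
For an admissible `λ` the exponents `λ + δ` are `k_1 + n, …, k_ℓ + n` with distinct `k_b < n - ℓ`,
followed by `n - ℓ - 1, …, 0`. Subtracting the columns `x ^ k_b` replaces `x ^ (k_b + n)` by
`x ^ k_b * (x ^ n - 1)`. Perturb the `n`-th roots of unity to `x_i = z_i * (1 + t * L(z_i))`. Then
`x_i ^ n - 1` is divisible by `t` with leading term `n * t * L(z_i)`, so the coefficient of `t ^ ℓ`
in the determinant is obtained by setting `t = 0` in the remaining factors, and the `b`-th column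
becomes `n * z ^ k_b * L(z)`. Take `L(z) = ∑ z ^ (-1 - a - k_b) * Y_{a b}`. The sums `a + k_b` are
distinct and less than `n`, because consecutive `k_b` differ by at least `ℓ`. As exponents matter
only modulo `n`, the entry `Y_{a b}` is therefore the coefficient of `z ^ (-1 - a)` in
`z ^ k_b * L(z)`, all other terms lying in the span of the low columns. Hence the coefficient of
`t ^ ℓ` is a nonzero constant times `det Y`.

A formula of size `s` computes a polynomial of degree at most `s`, so this coefficient is a linear
combination of the values at `s + 1` constants `t`, and at each of them the perturbed points are
affine forms in the entries of `Y`.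
-/

section BlockDeterminants

open Matrix

variable {R ι κ : Type*} [CommRing R] [Fintype ι] [Fintype κ] [DecidableEq ι] [DecidableEq κ]

theorem det_fromCols_mul_add_mul (P : Matrix (ι ⊕ κ) ι R) (Q : Matrix (ι ⊕ κ) κ R)
    (Y : Matrix ι ι R) (B : Matrix κ ι R) :
    (fromCols (P * Y + Q * B) Q).det = (fromCols P Q).det * Y.det := by
  have hmul : fromCols (P * Y + Q * B) Q = fromCols P Q * fromBlocks Y 0 B 1 := by
    rw [fromCols_mul_fromBlocks, Matrix.mul_zero, Matrix.mul_one, zero_add]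
  rw [hmul, det_mul, det_fromBlocks_zero₁₂, det_one, mul_one]

theorem det_fromCols_smul_left (c : R) (P : Matrix (ι ⊕ κ) ι R) (Q : Matrix (ι ⊕ κ) κ R) :
    (fromCols (c • P) Q).det = c ^ Fintype.card ι * (fromCols P Q).det := by
  simpa [mul_comm] using det_fromCols_mul_add_mul P Q (c • 1) 0

theorem coeff_card_det_fromCols_X_smul (A : Matrix (ι ⊕ κ) ι (Polynomial R))
    (B : Matrix (ι ⊕ κ) κ (Polynomial R)) :
    (fromCols ((Polynomial.X : Polynomial R) • A) B).det.coeff (Fintype.card ι) =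
      (fromCols (A.map (Polynomial.eval 0)) (B.map (Polynomial.eval 0))).det := by
  rw [det_fromCols_smul_left, Polynomial.coeff_X_pow_mul', if_pos le_rfl, Nat.sub_self,
    Polynomial.coeff_zero_eq_eval_zero, ← Polynomial.coe_evalRingHom, RingHom.map_det,
    RingHom.mapMatrix_apply, fromCols_map]

end BlockDeterminants

section GeneralizedVandermonde

open Matrix

variable {R S ι κ : Type*} [CommRing R] [CommRing S]

/-- The generalized Vandermonde matrix `(x_i ^ μ_j)` of a family of points and a family of
exponents, both indexed by arbitrary types. -/
def genVandermonde (x : ι → R) (μ : κ → ℕ) : Matrix ι κ R :=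
  Matrix.of fun i j => x i ^ μ j

theorem map_genVandermonde (f : R →+* S) (x : ι → R) (μ : κ → ℕ) :
    (genVandermonde x μ).map f = genVandermonde (f ∘ x) μ := by
  ext i j
  simp [genVandermonde]

theorem genVandermonde_sumElim {κ' : Type*} (x : ι → R) (μ : κ → ℕ) (ν : κ' → ℕ) :
    genVandermonde x (Sum.elim μ ν) = fromCols (genVandermonde x μ) (genVandermonde x ν) := by
  ext i (j | j) <;> rfl

theorem aeval_genVandermondeDet {A : Type*} [CommRing A] [Algebra ℂ A] {n : ℕ} (x : Fin n → A)
    (μ : Fin n → ℕ) :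
    MvPolynomial.aeval x (genVandermondeDet μ) = (genVandermonde x μ).det := by
  rw [genVandermondeDet, AlgHom.map_det]
  congr 1
  ext i j
  simp [genVandermonde]

theorem det_genVandermonde_ne_zero [IsDomain R] [Fintype ι] [DecidableEq ι] {n : ℕ}
    (e : ι ≃ Fin n) {x : ι → R} (hx : Function.Injective x) :
    (genVandermonde x fun j => (e j : ℕ)).det ≠ 0 := by
  have hsub : genVandermonde x (fun j => (e j : ℕ)) =
      (vandermonde (x ∘ e.symm)).submatrix e e := by
    ext i j
    simp [genVandermonde, vandermonde_apply]
  rw [hsub, det_submatrix_equiv_self, det_vandermonde_ne_zero_iff]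
  exact hx.comp e.symm.injective

end GeneralizedVandermonde

section RootsOfUnity

open Matrix

variable {R : Type*} [CommRing R]

theorem sum_pow_mul_eq_sum_fin {σ : Type*} [Fintype σ] {n : ℕ} [NeZero n] {z : R}
    (hz : z ^ n = 1) (e : σ → ℕ) (y : σ → R) :
    ∑ p, z ^ e p * y p = ∑ r : Fin n, z ^ (r : ℕ) * ∑ p with Fin.ofNat n (e p) = r, y p := by
  rw [← Finset.sum_fiberwise _ fun p => Fin.ofNat n (e p)]
  refine Finset.sum_congr rfl fun r _ => ?_
  rw [Finset.mul_sum]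
  refine Finset.sum_congr rfl fun p hp => ?_
  rw [← (Finset.mem_filter.1 hp).2, Fin.val_ofNat, ← pow_eq_pow_mod _ hz]

variable {ℓ m : ℕ}

/-- The exponents `ℓ + m - 1, …, 1, 0`, with the `ℓ` highest ones separated from the others. -/
def degreeEquiv (ℓ m : ℕ) : Fin ℓ ⊕ Fin m ≃ Fin (ℓ + m) :=
  finSumFinEquiv.trans Fin.revPerm

theorem val_degreeEquiv_inl (a : Fin ℓ) :
    (degreeEquiv ℓ m (Sum.inl a) : ℕ) = ℓ + m - 1 - a := by
  simp only [degreeEquiv, Equiv.trans_apply, finSumFinEquiv_apply_left, Fin.revPerm_apply,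
    Fin.val_rev, Fin.val_castAdd]
  omega

theorem val_degreeEquiv_inr (c : Fin m) : (degreeEquiv ℓ m (Sum.inr c) : ℕ) = c.rev := by
  simp only [degreeEquiv, Equiv.trans_apply, finSumFinEquiv_apply_right, Fin.revPerm_apply,
    Fin.val_rev, Fin.val_natAdd]
  omega

/-- The linear form `∑ z ^ (-1 - a - k_b) * Y_{a b}` in the entries of `Y`, in which `z` stands for
an `(ℓ + m)`-th root of unity, so that `ℓ + m` can be added to the exponents; as `a + k_b < ℓ + m`,
no subtraction truncates. The point `z` is perturbed in the direction of this form. -/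
def perturbation (k : Fin ℓ → Fin m) (Y : Matrix (Fin ℓ) (Fin ℓ) R) (z : R) : R :=
  ∑ p : Fin ℓ × Fin ℓ, z ^ (ℓ + m - 1 - p.1 - k p.2) * Y p.1 p.2

theorem ofNat_eq_degreeEquiv_inl_iff [NeZero (ℓ + m)] {k : Fin ℓ → Fin m}
    (hk : Function.Injective fun p : Fin ℓ × Fin ℓ => (p.1 : ℕ) + k p.2) (p : Fin ℓ × Fin ℓ)
    (a b : Fin ℓ) :
    Fin.ofNat (ℓ + m) (k b + (ℓ + m - 1 - p.1 - k p.2)) = degreeEquiv ℓ m (Sum.inl a) ↔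
      p = (a, b) := by
  have hcancel : k b + (ℓ + m - 1 - p.1 - k p.2) ≡ ℓ + m - 1 - a [MOD ℓ + m] ↔
      a + k b ≡ p.1 + k p.2 [MOD ℓ + m] := by
    rw [← Nat.ModEq.add_iff_right (Nat.ModEq.refl (p.1 + k p.2 + a + 1 : ℕ)),
      show k b + (ℓ + m - 1 - p.1 - k p.2) + (p.1 + k p.2 + a + 1) = a + k b + (ℓ + m) by omega,
      show ℓ + m - 1 - a + (p.1 + k p.2 + a + 1) = p.1 + k p.2 + (ℓ + m) by omega]
    simp [Nat.ModEq]
  have hlt (q : Fin ℓ × Fin ℓ) : q.1 + (k q.2 : ℕ) < ℓ + m := by omega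
  rw [Fin.ext_iff, Fin.val_ofNat, val_degreeEquiv_inl, ← hk.eq_iff]
  calc (k b + (ℓ + m - 1 - p.1 - k p.2)) % (ℓ + m) = ℓ + m - 1 - a
      ↔ k b + (ℓ + m - 1 - p.1 - k p.2) ≡ ℓ + m - 1 - a [MOD ℓ + m] := by
        rw [Nat.ModEq, Nat.mod_eq_of_lt (by omega : ℓ + m - 1 - a < ℓ + m)]
    _ ↔ a + k b ≡ p.1 + k p.2 [MOD ℓ + m] := hcancel
    _ ↔ (p.1 : ℕ) + k p.2 = a + k b :=
        ⟨fun h => (h.eq_of_lt_of_lt (hlt (a, b)) (hlt p)).symm, fun h => by rw [h]⟩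

theorem exists_of_pow_mul_perturbation_eq [NeZero (ℓ + m)] {ι : Type*} {k : Fin ℓ → Fin m}
    (hk : Function.Injective fun p : Fin ℓ × Fin ℓ => (p.1 : ℕ) + k p.2)
    (Y : Matrix (Fin ℓ) (Fin ℓ) R) {z : ι → R} (hz : ∀ i, z i ^ (ℓ + m) = 1) :
    ∃ B : Matrix (Fin m) (Fin ℓ) R,
      Matrix.of (fun i b => z i ^ (k b : ℕ) * perturbation k Y (z i)) =
        genVandermonde z (fun a => (degreeEquiv ℓ m (Sum.inl a) : ℕ)) * Y +
          genVandermonde z (fun c => (degreeEquiv ℓ m (Sum.inr c) : ℕ)) * B := by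
  let e (b : Fin ℓ) (p : Fin ℓ × Fin ℓ) : ℕ := k b + (ℓ + m - 1 - p.1 - k p.2)
  let coeff (r : Fin (ℓ + m)) (b : Fin ℓ) : R :=
    ∑ p with Fin.ofNat (ℓ + m) (e b p) = r, Y p.1 p.2
  have hY (a b : Fin ℓ) : coeff (degreeEquiv ℓ m (Sum.inl a)) b = Y a b := by
    simp only [coeff, e, ofNat_eq_degreeEquiv_inl_iff hk, Finset.filter_eq', Finset.mem_univ,
      if_true, Finset.sum_singleton]
  refine ⟨Matrix.of fun c b => coeff (degreeEquiv ℓ m (Sum.inr c)) b, ?_⟩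
  ext i b
  calc z i ^ (k b : ℕ) * perturbation k Y (z i)
      = ∑ p, z i ^ e b p * Y p.1 p.2 := by
        simp only [perturbation, e, Finset.mul_sum, pow_add, mul_assoc]
    _ = ∑ j, z i ^ (degreeEquiv ℓ m j : ℕ) * coeff (degreeEquiv ℓ m j) b := by
        rw [sum_pow_mul_eq_sum_fin (hz i), ← Equiv.sum_comp (degreeEquiv ℓ m)]
    _ = _ := by
        simp [Fintype.sum_sum_type, hY, genVandermonde, Matrix.mul_apply]

theorem det_genVandermonde_add_const_sumElim (x : Fin ℓ ⊕ Fin m → R) (k : Fin ℓ → Fin m) (N : ℕ) :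
    (genVandermonde x (Sum.elim (fun b => (k b : ℕ) + N) fun c : Fin m => (c.rev : ℕ))).det =
      (fromCols (Matrix.of fun i b => x i ^ (k b : ℕ) * (x i ^ N - 1))
        (genVandermonde x fun c : Fin m => (c.rev : ℕ))).det := by
  let E : Matrix (Fin m) (Fin ℓ) R := Matrix.of fun c b => if c = (k b).rev then 1 else 0
  have hcols : genVandermonde x (fun b => (k b : ℕ) + N) =
      Matrix.of (fun i b => x i ^ (k b : ℕ) * (x i ^ N - 1)) * (1 : Matrix (Fin ℓ) (Fin ℓ) R) +
        genVandermonde x (fun c : Fin m => (c.rev : ℕ)) * E := by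
    rw [Matrix.mul_one]
    ext i b
    simp only [genVandermonde, E, Matrix.mul_apply, of_apply, Matrix.add_apply, mul_ite, mul_one,
      mul_zero, Finset.sum_ite_eq', Finset.mem_univ, if_true, Fin.rev_rev, pow_add]
    ring
  rw [genVandermonde_sumElim, hcols, det_fromCols_mul_add_mul, det_one, mul_one]

theorem exists_C_mul_one_add_X_mul_C_pow_sub_one_eq {N : ℕ} {z : R} (hz : z ^ N = 1) (u : R) :
    ∃ q : Polynomial R,
      (Polynomial.C z * (1 + Polynomial.X * Polynomial.C u)) ^ N - 1 = Polynomial.X * q ∧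
        q.eval 0 = N * u := by
  refine ⟨Polynomial.C u * ∑ r ∈ Finset.range N, (1 + Polynomial.X * Polynomial.C u) ^ r, ?_, ?_⟩
  · rw [mul_pow, ← map_pow, hz, map_one, one_mul, ← mul_geom_sum]
    ring
  · simp [Polynomial.eval_finsetSum, mul_comm u]

/-- The point `z` moved to first order in the parameter `Polynomial.X`, in the direction
`z * perturbation k Y z`. -/
noncomputable def perturbedPoint (k : Fin ℓ → Fin m) (Y : Matrix (Fin ℓ) (Fin ℓ) R) (z : R) :
    Polynomial R :=
  Polynomial.C z * (1 + Polynomial.X * Polynomial.C (perturbation k Y z))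

theorem eval_perturbedPoint (k : Fin ℓ → Fin m) (Y : Matrix (Fin ℓ) (Fin ℓ) R) (z c : R) :
    (perturbedPoint k Y z).eval c = z * (1 + c * perturbation k Y z) := by
  simp only [perturbedPoint, Polynomial.eval_mul, Polynomial.eval_add, Polynomial.eval_one,
    Polynomial.eval_X, Polynomial.eval_C]

theorem natDegree_perturbedPoint_le (k : Fin ℓ → Fin m) (Y : Matrix (Fin ℓ) (Fin ℓ) R) (z : R) :
    (perturbedPoint k Y z).natDegree ≤ 1 := by
  refine (Polynomial.natDegree_C_mul_le _ _).trans ?_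
  compute_degree

theorem exists_of_pow_mul_perturbedPoint_pow_sub_one_eq {ι : Type*} (k : Fin ℓ → Fin m)
    (Y : Matrix (Fin ℓ) (Fin ℓ) R) {z : ι → R} {N : ℕ} (hz : ∀ i, z i ^ N = 1) :
    ∃ A : Matrix ι (Fin ℓ) (Polynomial R),
      Matrix.of (fun i b => perturbedPoint k Y (z i) ^ (k b : ℕ) *
        (perturbedPoint k Y (z i) ^ N - 1)) = (Polynomial.X : Polynomial R) • A ∧
      A.map (Polynomial.eval 0) =
        (N : R) • Matrix.of fun i b => z i ^ (k b : ℕ) * perturbation k Y (z i) := by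
  choose q hq hq_zero using fun i =>
    exists_C_mul_one_add_X_mul_C_pow_sub_one_eq (hz i) (perturbation k Y (z i))
  refine ⟨Matrix.of fun i b => perturbedPoint k Y (z i) ^ (k b : ℕ) * q i, ?_, ?_⟩
  · ext1 i b
    simp only [perturbedPoint, hq, of_apply, Matrix.smul_apply, smul_eq_mul]
    ring
  · ext i b
    simp only [map_apply, of_apply, Matrix.smul_apply, smul_eq_mul, Polynomial.eval_mul,
      Polynomial.eval_pow, eval_perturbedPoint, hq_zero]
    ring

theorem coeff_det_genVandermonde_perturbedPoint [NeZero (ℓ + m)] {k : Fin ℓ → Fin m}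
    (hk : Function.Injective fun p : Fin ℓ × Fin ℓ => (p.1 : ℕ) + k p.2)
    (Y : Matrix (Fin ℓ) (Fin ℓ) R) {z : Fin ℓ ⊕ Fin m → R} (hz : ∀ i, z i ^ (ℓ + m) = 1) :
    (genVandermonde (fun i => perturbedPoint k Y (z i))
        (Sum.elim (fun b => (k b : ℕ) + (ℓ + m)) fun c : Fin m => (c.rev : ℕ))).det.coeff ℓ =
      ((ℓ + m : ℕ) : R) ^ ℓ * (genVandermonde z fun j => (degreeEquiv ℓ m j : ℕ)).det * Y.det := by
  obtain ⟨A, hX, hA⟩ := exists_of_pow_mul_perturbedPoint_pow_sub_one_eq k Y hz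
  obtain ⟨B, hB⟩ := exists_of_pow_mul_perturbation_eq hk Y hz
  set low : Fin m → ℕ := fun c => (c.rev : ℕ)
  have hlow : (fun c => (degreeEquiv ℓ m (Sum.inr c) : ℕ)) = low := funext val_degreeEquiv_inr
  have hlow_zero : (genVandermonde (fun i => perturbedPoint k Y (z i)) low).map
      (Polynomial.eval 0) = genVandermonde z low := by
    ext i c
    simp [genVandermonde, eval_perturbedPoint]
  have hz_split : genVandermonde z (fun j => (degreeEquiv ℓ m j : ℕ)) =
      fromCols (genVandermonde z fun a => (degreeEquiv ℓ m (Sum.inl a) : ℕ))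
        (genVandermonde z low) := by
    rw [← hlow, ← genVandermonde_sumElim]
    exact congrArg _ (Sum.elim_comp_inl_inr _).symm
  have hcoeff := coeff_card_det_fromCols_X_smul A
    (genVandermonde (fun i => perturbedPoint k Y (z i)) low)
  rw [Fintype.card_fin] at hcoeff
  rw [det_genVandermonde_add_const_sumElim, hX, hcoeff, hA, hlow_zero, det_fromCols_smul_left,
    Fintype.card_fin, hB, hlow, det_fromCols_mul_add_mul, hz_split, mul_assoc]

end RootsOfUnity

section Interpolation

variable {K R ι : Type*} [Field K] [CommRing R] [IsDomain R] [Algebra K R] [DecidableEq ι]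

theorem eq_sum_eval_smul_lagrange_basis {s : Finset ι} {v : ι → K} (hv : Set.InjOn v s)
    {Q : Polynomial R} (hQ : Q.degree < s.card) :
    Q = ∑ i ∈ s,
      Q.eval (algebraMap K R (v i)) • (Lagrange.basis s v i).map (algebraMap K R) := by
  refine Polynomial.eq_of_degrees_lt_of_eval_index_eq s
    ((algebraMap K R).injective.comp_injOn hv) hQ ?_ fun i hi => ?_
  · refine Polynomial.mem_degreeLT.1 (Submodule.sum_mem _ fun i hi => Submodule.smul_mem _ _ ?_)
    have hcard : s.card - 1 < s.card := Nat.sub_lt (Finset.card_pos.2 ⟨i, hi⟩) one_pos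
    rw [Polynomial.mem_degreeLT, Polynomial.degree_map, Lagrange.degree_basis hv hi]
    exact_mod_cast hcard
  · rw [Polynomial.eval_finsetSum, Finset.sum_eq_single_of_mem i hi]
    · rw [Function.comp_apply, Polynomial.eval_smul, Polynomial.eval_map_apply,
        Lagrange.eval_basis_self hv hi, map_one,
        smul_eq_mul, mul_one]
    · intro j _ hj
      rw [Function.comp_apply, Polynomial.eval_smul, Polynomial.eval_map_apply,
        Lagrange.eval_basis_of_ne hj hi, map_zero, smul_zero]

end Interpolation

section Curves

variable {K R σ : Type*} [CommSemiring K] [CommSemiring R] [Algebra K R]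

theorem eval_mvPolynomial_aeval (x : σ → Polynomial R) (P : MvPolynomial σ K) (c : R) :
    (MvPolynomial.aeval x P).eval c = MvPolynomial.aeval (fun i => (x i).eval c) P := by
  simpa only [AlgHom.restrictScalars_apply, Polynomial.coe_aeval_eq_eval] using
    MvPolynomial.comp_aeval_apply x ((Polynomial.aeval (R := R) c).restrictScalars K) P

theorem natDegree_aeval_le_totalDegree_mul {x : σ → Polynomial R} {e : ℕ}
    (hx : ∀ i, (x i).natDegree ≤ e) (P : MvPolynomial σ K) :
    (MvPolynomial.aeval x P).natDegree ≤ P.totalDegree * e := by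
  have hmap : (P.map (algebraMap K R)).totalDegree ≤ P.totalDegree :=
    Finset.sup_mono (MvPolynomial.support_map_subset _ P)
  rw [← MvPolynomial.aeval_map_algebraMap R x P]
  exact MvPolynomial.aeval_natDegree_le _ hmap x hx

end Curves

namespace AlgFormula

variable {K σ τ : Type}

/-- The formula obtained by replacing every variable leaf `x` by the formula `g x`. -/
def subst (g : σ → AlgFormula K τ) : AlgFormula K σ → AlgFormula K τ
  | var x => g x
  | const a => const a
  | sum k c f => sum k c fun i => (f i).subst g
  | prod k f => prod k fun i => (f i).subst g

theorem toPoly_subst [Field K] (g : σ → AlgFormula K τ) (F : AlgFormula K σ) :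
    (F.subst g).toPoly = MvPolynomial.aeval (fun x => (g x).toPoly) F.toPoly := by
  induction F with
  | var x => simp [subst, toPoly]
  | const a => simp [subst, toPoly]
  | sum k c f ih => simp [subst, toPoly, ih]
  | prod k f ih => simp [subst, toPoly, ih]

theorem size_subst_le (g : σ → AlgFormula K τ) {t : ℕ} (ht : 1 ≤ t) (hg : ∀ x, (g x).size ≤ t)
    (F : AlgFormula K σ) : (F.subst g).size ≤ F.size * t := by
  induction F with
  | var x => simpa [subst, size] using hg x
  | const a => simpa [subst, size] using ht
  | sum k c f ih | prod k f ih =>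
    simp only [subst, size, add_mul, Finset.sum_mul, one_mul]
    exact add_le_add ht (Finset.sum_le_sum fun i _ => ih i)

theorem depth_subst_le (g : σ → AlgFormula K τ) {d : ℕ} (hg : ∀ x, (g x).depth ≤ d)
    (F : AlgFormula K σ) : (F.subst g).depth ≤ F.depth + d := by
  induction F with
  | var x => simpa [subst, depth] using hg x
  | const a => simp [subst, depth]
  | sum k c f ih | prod k f ih =>
    simp only [subst, depth, add_assoc]
    gcongr
    refine Finset.sup_le fun i _ => (ih i).trans ?_
    gcongr
    exact Finset.le_sup (f := fun i => (f i).depth) (Finset.mem_univ i)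

theorem totalDegree_toPoly_le_size [Field K] (F : AlgFormula K σ) :
    F.toPoly.totalDegree ≤ F.size := by
  induction F with
  | var x => simp [toPoly, size]
  | const a => simp [toPoly, size]
  | sum k c f ih =>
    refine MvPolynomial.totalDegree_finsetSum_le fun i _ => ?_
    calc (MvPolynomial.C (c i) * (f i).toPoly).totalDegree
        ≤ (f i).toPoly.totalDegree := by
          simpa using MvPolynomial.totalDegree_mul (MvPolynomial.C (c i)) (f i).toPoly
      _ ≤ (f i).size := ih i
      _ ≤ ∑ j, (f j).size :=
          Finset.single_le_sum (f := fun j => (f j).size) (fun _ _ => Nat.zero_le _)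
            (Finset.mem_univ i)
      _ ≤ (sum k c f).size := Nat.le_add_left _ _
  | prod k f ih =>
    calc (∏ i, (f i).toPoly).totalDegree
        ≤ ∑ i, (f i).toPoly.totalDegree := MvPolynomial.totalDegree_finsetProd _ _
      _ ≤ ∑ i, (f i).size := Finset.sum_le_sum fun i _ => ih i
      _ ≤ (prod k f).size := Nat.le_add_left _ _

end AlgFormula

namespace HasFormula

variable {K σ τ : Type} [Field K]

theorem totalDegree_le {P : MvPolynomial σ K} {s Δ : ℕ} (hP : HasFormula P s Δ) :
    P.totalDegree ≤ s := by
  obtain ⟨F, rfl, hs, -⟩ := hP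
  exact F.totalDegree_toPoly_le_size.trans hs

theorem mono_size {P : MvPolynomial σ K} {s t Δ : ℕ} (hP : HasFormula P s Δ) (hst : s ≤ t) :
    HasFormula P t Δ := by
  obtain ⟨F, hF, hs, hΔ⟩ := hP
  exact ⟨F, hF, hs.trans hst, hΔ⟩

theorem aeval {P : MvPolynomial σ K} {g : σ → MvPolynomial τ K} {s Δ t d : ℕ}
    (hP : HasFormula P s Δ) (ht : 1 ≤ t) (hg : ∀ x, HasFormula (g x) t d) :
    HasFormula (MvPolynomial.aeval g P) (s * t) (Δ + d) := by
  obtain ⟨F, rfl, hs, hΔ⟩ := hP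
  choose G hG hGt hGd using hg
  refine ⟨F.subst G, ?_, ?_, ?_⟩
  · rw [F.toPoly_subst, funext hG]
  · exact (F.size_subst_le G ht hGt).trans (Nat.mul_le_mul_right t hs)
  · exact (F.depth_subst_le G hGd).trans (Nat.add_le_add_right hΔ d)

theorem sum_C_mul {k : ℕ} (c : Fin (k + 1) → K) {P : Fin (k + 1) → MvPolynomial σ K} {s Δ : ℕ}
    (hP : ∀ i, HasFormula (P i) s Δ) :
    HasFormula (∑ i, MvPolynomial.C (c i) * P i) (1 + (k + 1) * s) (Δ + 1) := by
  choose F hF hs hΔ using hP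
  refine ⟨AlgFormula.sum k c F, by simp only [AlgFormula.toPoly, hF], ?_, ?_⟩
  · simpa [AlgFormula.size] using Finset.sum_le_sum fun i (_ : i ∈ Finset.univ) => hs i
  · rw [AlgFormula.depth, add_comm]
    exact Nat.add_le_add_right (Finset.sup_le fun i _ => hΔ i) 1

theorem C_add_sum_C_mul_X [Fintype σ] (a : K) (c : σ → K) :
    HasFormula (MvPolynomial.C a + ∑ x, MvPolynomial.C (c x) * MvPolynomial.X x)
      (Fintype.card σ + 2) 1 := by
  let e := (Fintype.equivFin σ).symm
  have hterm : ∀ i, HasFormula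
      (Fin.cons (α := fun _ => MvPolynomial σ K) 1 (fun i => MvPolynomial.X (e i)) i) 1 0 := by
    refine Fin.cases ⟨AlgFormula.const 1, ?_⟩ fun i => ⟨AlgFormula.var (e i), ?_⟩ <;>
      simp [AlgFormula.toPoly, AlgFormula.size, AlgFormula.depth]
  have hsum := sum_C_mul (Fin.cons a fun i => c (e i)) hterm
  simp only [Fin.sum_univ_succ, Fin.cons_zero, Fin.cons_succ, mul_one,
    e.sum_comp fun x => MvPolynomial.C (c x) * (MvPolynomial.X x : MvPolynomial σ K)] at hsum
  convert hsum using 1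
  omega

theorem C_mul_coeff_of_eval [Infinite K] {Q : Polynomial (MvPolynomial σ K)} {D s Δ : ℕ}
    (hD : Q.natDegree ≤ D) (hQ : ∀ c, HasFormula (Q.eval (MvPolynomial.C c)) s Δ) (v : K) (r : ℕ) :
    HasFormula (MvPolynomial.C v * Q.coeff r) (1 + (D + 1) * s) (Δ + 1) := by
  let node (j : Fin (D + 1)) : K := Infinite.natEmbedding K j
  have hnode : Function.Injective node :=
    (Infinite.natEmbedding K).injective.comp Fin.val_injective
  have hdeg : Q.degree < (Finset.univ : Finset (Fin (D + 1))).card := by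
    rw [Finset.card_univ, Fintype.card_fin]
    exact (Polynomial.degree_le_of_natDegree_le hD).trans_lt (by exact_mod_cast Nat.lt_succ_self D)
  have hcoeff := congrArg (fun Q => Polynomial.coeff Q r)
    (eq_sum_eval_smul_lagrange_basis (s := Finset.univ) (v := node) hnode.injOn hdeg)
  simp only [Polynomial.finsetSum_coeff, Polynomial.coeff_smul, Polynomial.coeff_map, smul_eq_mul,
    MvPolynomial.algebraMap_eq] at hcoeff
  have hsum : MvPolynomial.C v * Q.coeff r =
      ∑ j, MvPolynomial.C (v * (Lagrange.basis Finset.univ node j).coeff r) *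
        Q.eval (MvPolynomial.C (node j)) := by
    rw [hcoeff, Finset.mul_sum]
    refine Finset.sum_congr rfl fun j _ => ?_
    rw [map_mul]
    ring
  exact hsum ▸ sum_C_mul _ fun j => hQ (node j)

theorem C_mul_coeff_aeval [Infinite K] {P : MvPolynomial σ K} {s Δ t d : ℕ}
    (hP : HasFormula P s Δ) (ht : 1 ≤ t) {x : σ → Polynomial (MvPolynomial τ K)}
    {e : ℕ} (hdeg : ∀ i, (x i).natDegree ≤ e)
    (hx : ∀ i c, HasFormula ((x i).eval (MvPolynomial.C c)) t d) (v : K) (r : ℕ) :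
    HasFormula (MvPolynomial.C v * (MvPolynomial.aeval x P).coeff r)
      (1 + (s * e + 1) * (s * t)) (Δ + d + 1) := by
  refine C_mul_coeff_of_eval ((natDegree_aeval_le_totalDegree_mul hdeg P).trans
    (Nat.mul_le_mul_right e hP.totalDegree_le)) (fun c => ?_) v r
  rw [eval_mvPolynomial_aeval]
  exact hP.aeval ht fun i => hx i c

end HasFormula

theorem injective_add_of_gap {κ : Type*} [LinearOrder κ] {ℓ : ℕ} {k : κ → ℕ}
    (hgap : ∀ i j, i < j → k j + ℓ ≤ k i) :
    Function.Injective fun p : Fin ℓ × κ => (p.1 : ℕ) + k p.2 := by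
  rintro ⟨a, i⟩ ⟨b, j⟩ h
  dsimp only at h
  rcases lt_trichotomy i j with hij | rfl | hij
  · have := hgap i j hij
    omega
  · rw [Fin.ext (Nat.add_right_cancel h)]
  · have := hgap j i hij
    omega

namespace Admissible

variable {ℓ n : ℕ} {lam : Fin ℓ → ℕ}

theorem add_sub_one_le (h : Admissible n lam) {i j : Fin ℓ} (hij : i < j) :
    lam j + (ℓ - 1) ≤ lam i := by
  obtain ⟨hℓ, hgap, -, -⟩ := h
  obtain ⟨ℓ, rfl⟩ := Nat.exists_eq_add_one.2 hℓ
  have : IsTrans ℕ fun a b => b + ℓ ≤ a := ⟨fun a b c hab hbc => by omega⟩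
  exact (Fin.liftFun_iff_succ (fun a b => b + ℓ ≤ a)).2
    (fun i => hgap i.castSucc i.succ (by simp)) hij

theorem antitone (h : Admissible n lam) : Antitone lam :=
  antitone_iff_forall_lt.2 fun _ _ hij => (Nat.le_add_right _ _).trans (h.add_sub_one_le hij)

theorem le_apply (h : Admissible n lam) (i : Fin ℓ) : ℓ ≤ lam i :=
  (h.2.2.1 ⟨ℓ - 1, Nat.sub_one_lt_of_lt h.1⟩ (Nat.sub_add_cancel h.1)).trans
    (h.antitone (Fin.le_def.2 (Nat.le_sub_one_of_lt i.isLt)))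

theorem apply_add_le (h : Admissible n lam) (i : Fin ℓ) : lam i + ℓ ≤ n :=
  (Nat.add_le_add_right (h.antitone (Fin.le_def.2 (Nat.zero_le _))) ℓ).trans
    (h.2.2.2 ⟨0, h.1⟩ rfl)

theorem exists_shiftedExponents_eq {m : ℕ} (h : Admissible (ℓ + m) lam) :
    ∃ k : Fin ℓ → Fin m, (Function.Injective fun p : Fin ℓ × Fin ℓ => (p.1 : ℕ) + k p.2) ∧
      ∀ j, shiftedExponents (ℓ + m) lam (finSumFinEquiv j) =
        Sum.elim (fun b => (k b : ℕ) + (ℓ + m)) (fun c : Fin m => (c.rev : ℕ)) j := by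
  refine ⟨fun b => ⟨lam b - 1 - b, ?_⟩,
    injective_add_of_gap (k := fun b => lam b - 1 - b) fun i j hij => ?_, ?_⟩
  · have := h.apply_add_le b
    have := h.le_apply b
    omega
  · have := h.add_sub_one_le hij
    have := h.le_apply j
    have := Fin.lt_def.1 hij
    omega
  · rintro (b | c)
    · have := h.le_apply b
      rw [finSumFinEquiv_apply_left, shiftedExponents,
        dif_pos (show (Fin.castAdd m b : ℕ) < ℓ from b.isLt)]
      change lam b + (ℓ + m - 1 - b) = lam b - 1 - b + (ℓ + m)
      omega
    · rw [finSumFinEquiv_apply_right, shiftedExponents,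
        dif_neg (show ¬(Fin.natAdd ℓ c : ℕ) < ℓ from Nat.not_lt.2 (Nat.le_add_right ℓ c)),
        Sum.elim_inr, Fin.val_natAdd, Fin.val_rev]
      omega

end Admissible

section Main

open Matrix

theorem hasFormula_eval_perturbedPoint {K : Type} [Field K] {ℓ m : ℕ} (k : Fin ℓ → Fin m)
    (ζ c : K) :
    HasFormula ((perturbedPoint k (mvPolynomialX (Fin ℓ) (Fin ℓ) K) (MvPolynomial.C ζ)).eval
      (MvPolynomial.C c)) (ℓ ^ 2 + 2) 1 := by
  convert HasFormula.C_add_sum_C_mul_X ζ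
    fun p : Fin ℓ × Fin ℓ => ζ * c * ζ ^ (ℓ + m - 1 - p.1 - k p.2) using 1
  · simp only [eval_perturbedPoint, perturbation, mvPolynomialX_apply, mul_add, mul_one,
      Finset.mul_sum, map_mul, map_pow, mul_assoc]
  · simp [sq]

theorem exists_coeff_aeval_genVandermondeDet_eq {ℓ m : ℕ} [NeZero (ℓ + m)] {k : Fin ℓ → Fin m}
    (hk : Function.Injective fun p : Fin ℓ × Fin ℓ => (p.1 : ℕ) + k p.2) {μ : Fin (ℓ + m) → ℕ}
    (hμ : ∀ j, μ (finSumFinEquiv j) =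
      Sum.elim (fun b => (k b : ℕ) + (ℓ + m)) (fun c : Fin m => (c.rev : ℕ)) j) :
    ∃ (ζ : Fin (ℓ + m) → ℂ) (v : ℂ), v ≠ 0 ∧
      (MvPolynomial.aeval (fun i => perturbedPoint k (mvPolynomialX (Fin ℓ) (Fin ℓ) ℂ)
        (MvPolynomial.C (ζ i))) (genVandermondeDet μ)).coeff ℓ =
          MvPolynomial.C v * symbolicDet ℓ := by
  have hω := Complex.isPrimitiveRoot_exp (ℓ + m) (NeZero.ne _)
  set ω := Complex.exp (2 * Real.pi * Complex.I / (ℓ + m : ℕ))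
  let z (i : Fin ℓ ⊕ Fin m) : ℂ := ω ^ (finSumFinEquiv i : ℕ)
  have hz_inj : Function.Injective z := fun i j hij =>
    finSumFinEquiv.injective (Fin.ext (hω.pow_inj (Fin.is_lt _) (Fin.is_lt _) hij))
  have hz_pow (i) : (MvPolynomial.C (z i) : MvPolynomial (Fin ℓ × Fin ℓ) ℂ) ^ (ℓ + m) = 1 := by
    rw [← map_pow, pow_right_comm, hω.pow_eq_one, one_pow, map_one]
  refine ⟨fun i => ω ^ (i : ℕ),
    ((ℓ + m : ℕ) : ℂ) ^ ℓ * (genVandermonde z fun j => (degreeEquiv ℓ m j : ℕ)).det,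
    mul_ne_zero (pow_ne_zero _ (NeZero.ne _)) (det_genVandermonde_ne_zero _ hz_inj), ?_⟩
  have hrows : (genVandermonde (fun i : Fin (ℓ + m) => perturbedPoint k
      (mvPolynomialX (Fin ℓ) (Fin ℓ) ℂ) (MvPolynomial.C (ω ^ (i : ℕ)))) μ).submatrix
        finSumFinEquiv finSumFinEquiv =
      genVandermonde (fun i => perturbedPoint k (mvPolynomialX (Fin ℓ) (Fin ℓ) ℂ)
        (MvPolynomial.C (z i)))
        (Sum.elim (fun b => (k b : ℕ) + (ℓ + m)) fun c : Fin m => (c.rev : ℕ)) := by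
    ext1 i j
    simp only [genVandermonde, submatrix_apply, of_apply, hμ, z]
  rw [aeval_genVandermondeDet, ← det_submatrix_equiv_self finSumFinEquiv, hrows,
    coeff_det_genVandermonde_perturbedPoint hk _ hz_pow, symbolicDet, map_mul, map_pow,
    map_natCast, RingHom.map_det, RingHom.mapMatrix_apply, map_genVandermonde]
  rfl

theorem hasFormula_symbolicDet {ℓ n : ℕ} {lam : Fin ℓ → ℕ} (h : Admissible n lam) {s Δ : ℕ}
    (hF : HasFormula (genVandermondeDet (shiftedExponents n lam)) s Δ) :
    HasFormula (symbolicDet ℓ) (1 + (s + 1) * (s * (s ^ 2 + 2))) (Δ + 2) := by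
  obtain ⟨m, rfl⟩ := Nat.exists_eq_add_of_le
    ((Nat.le_add_left _ _).trans (h.apply_add_le ⟨0, h.1⟩))
  have : NeZero (ℓ + m) := ⟨(Nat.add_pos_left h.1 m).ne'⟩
  obtain ⟨k, hk, hμ⟩ := h.exists_shiftedExponents_eq
  obtain ⟨ζ, v, hv, hcoeff⟩ := exists_coeff_aeval_genVandermondeDet_eq hk hμ
  have hdeg (i : Fin (ℓ + m)) := natDegree_perturbedPoint_le k
    (mvPolynomialX (Fin ℓ) (Fin ℓ) ℂ) (MvPolynomial.C (ζ i))
  have hcoeff_ne_zero := mul_ne_zero (MvPolynomial.C_ne_zero.2 hv)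
    (det_mvPolynomialX_ne_zero (Fin ℓ) ℂ)
  have hℓs : ℓ ≤ s :=
    calc ℓ ≤ _ := Polynomial.le_natDegree_of_ne_zero (hcoeff.trans_ne hcoeff_ne_zero)
      _ ≤ _ := natDegree_aeval_le_totalDegree_mul hdeg _
      _ ≤ s := by simpa only [mul_one] using hF.totalDegree_le
  have hpoint (i : Fin (ℓ + m)) (c : ℂ) := (hasFormula_eval_perturbedPoint k (ζ i) c).mono_size
    (Nat.add_le_add_right (Nat.pow_le_pow_left hℓs 2) 2)
  have hdet := hF.C_mul_coeff_aeval (Nat.le_add_left 1 _) hdeg hpoint v⁻¹ ℓ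
  rwa [hcoeff, ← mul_assoc, ← map_mul, inv_mul_cancel₀ hv, map_one, one_mul, mul_one s] at hdet

theorem exists_admissible_le {ℓ : ℕ} (hℓ : 0 < ℓ) : ∃ (n : ℕ) (lam : Fin ℓ → ℕ),
    Admissible n lam ∧ n ≤ 2 * ℓ ^ 2 + ℓ ∧
      ∀ j : Fin n, shiftedExponents n lam j ≤ 2 * ℓ ^ 2 + ℓ := by
  have hle (i : ℕ) : ℓ * (ℓ - i) ≤ ℓ ^ 2 := by
    rw [sq]
    exact Nat.mul_le_mul_left _ (Nat.sub_le _ _)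
  refine ⟨ℓ ^ 2 + ℓ, fun i => ℓ * (ℓ - i), ⟨hℓ, fun i j hij => ?_, fun i hi => ?_, fun i _ => ?_⟩,
    by omega, fun j => ?_⟩
  · dsimp only
    rw [show ℓ - (i : ℕ) = (ℓ - j) + 1 by omega, mul_add]
    omega
  · dsimp only
    rw [show ℓ - (i : ℕ) = 1 by omega, mul_one]
  · exact Nat.add_le_add_right (hle _) _
  · have := hle j
    unfold shiftedExponents
    split
    · dsimp only
      omega
    · omega

end Main

theorem mainTheorem3 :
    (∃ (p : Polynomial ℕ) (c : ℕ), ∀ (ℓ n : ℕ) (lam : Fin ℓ → ℕ), Admissible n lam →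
      ∀ s Δ : ℕ, HasFormula (genVandermondeDet (shiftedExponents n lam)) s Δ →
        HasFormula (symbolicDet ℓ) (p.eval s) (Δ + c)) ∧
    (∃ q : Polynomial ℕ, ∀ ℓ : ℕ, 0 < ℓ → ∃ (n : ℕ) (lam : Fin ℓ → ℕ),
      Admissible n lam ∧ n ≤ q.eval ℓ ∧ ∀ j : Fin n, shiftedExponents n lam j ≤ q.eval ℓ) := by
  refine ⟨⟨1 + (Polynomial.X + 1) * (Polynomial.X * (Polynomial.X ^ 2 + 2)), 2,
    fun ℓ n lam h s Δ hF => ?_⟩, ⟨2 * Polynomial.X ^ 2 + Polynomial.X, fun ℓ hℓ => ?_⟩⟩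
  · simpa using hasFormula_symbolicDet h hF
  · simpa using exists_admissible_le hℓ
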